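/- Let $\mathcal N_2$ denote the class of all groups that are nilpotent of class at most two, i.e. groups $K$ with $[[K,K],K]=\{e\}$. Let $G\in\mathcal N_2$ and let $H$ be a subgroup of $G$. The $\mathcal N_2$-dominion of $H$ in $G$ is the subgroup $$\mathrm{dom}_G^{\mathcal N_2}(H)=\{a\in G : \text{for every } K\in\mathcal N_2 \text{ and all homomorphisms } f,g\colon G\to K,\ \text{if } f|_H=g|_H \text{ then } f(a)=g(a)\},$$ which contains $H$. Then: 1. for every $d\in\mathrm{dom}_G^{\mathcal N_2}(H)$ there is an integer $n>0$ with $d^n\in H$; 2. $H$ is a normal subgroup of $\mathrm{dom}_G^{\mathcal N_2}(H)$; 3. if $G$ is finitely generated, then $H$ has finite index in $\mathrm{dom}_G^{\mathcal N_2}(H)$. -/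

import Mathlib

universe u

/-- A group `G` lies in the variety `𝒩_c` of nilpotent groups of class at most `c`:
the term `G_{c+1}` of the lower central series, where `G_1 = G` and `G_{i+1} = [G_i, G]`, is trivial.
Mathlib numbers the series from `0`, so that `G_{c+1}` is the term with index `c`. -/
def IsNilpotentOfClassLE (c : ℕ) (G : Type u) [Group G] : Prop :=
  Subgroup.lowerCentralSeries (⊤ : Subgroup G) c = ⊥

/-- The dominion of a subgroup `H` of `G` in a full subcategory of the category of groups, given by
the class `C` of its objects: the elements `a` of `G` such that any two homomorphisms from `G` to
a group in `C` which agree on `H` also agree at `a`. -/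
def dominion (C : (K : Type u) → [Group K] → Prop) {G : Type u} [Group G] (H : Subgroup G) :
    Subgroup G where
  carrier := {a | ∀ (K : Type u) [Group K], C K →
    ∀ f g : G →* K, (∀ h ∈ H, f h = g h) → f a = g a}
  one_mem' := by
    intro K _ _ f g _
    simp
  mul_mem' := by
    intro a b ha hb K _ hK f g hfg
    rw [map_mul, map_mul, ha K hK f g hfg, hb K hK f g hfg]
  inv_mem' := by
    intro a ha K _ hK f g hfg
    rw [map_inv, map_inv, ha K hK f g hfg]

/-! Let `D` be the dominion and `G'` the derived subgroup, which is central. Testing on the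
abelianization modulo the image of `H` gives `D ≤ H G'`. So `D` acts on `H` by inner automorphisms
of `H`, and `D / H` is an image of `D ∩ G'`, which is finitely generated abelian if `G` is finitely
generated. Everything then rests on torsion: each `c ∈ D ∩ G'` has a positive power in `H`.

If not, some character `i` of the center with values in `ℚ` kills `H ∩ Z(G)` and has `i c = 1`. The
alternating form `ω(x, y) = i ⁅x, y⁆` vanishes on `H`. There is `s : G → ℚ` with `s (x y) = s x + s
y + ω(x, y) / 2` and `s = i` on `G'` (`exists_quadratic_extension`). On `H` it is additive and kills
`H ∩ G'`, so it extends from `H` to a homomorphism `l : G → ℚ`. Let `j : G → V` be the map to the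
rationalized abelianization and `p` a projection onto the span of `j H`. In the Heisenberg group `V
× ℚ` with cocycle `ω / 2`, the homomorphisms `x ↦ (j x, s x)` and `x ↦ (p (j x), l x)` agree on `H`,
but `s c = 1` and `l c = 0`. -/

open scoped TensorProduct commutatorElement

/-! ### Commutators in class two and finite generation -/

section ClassTwo

variable {G : Type u} [Group G]

theorem isNilpotentOfClassLE_two_iff :
    IsNilpotentOfClassLE 2 G ↔ commutator G ≤ Subgroup.center G := by
  unfold IsNilpotentOfClassLE
  rw [Subgroup.lowerCentralSeries_succ, Subgroup.commutator_top_right_eq_bot_iff_le_center,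
    Subgroup.top_lowerCentralSeries_one]

theorem commutatorElement_mem_commutator (x y : G) : ⁅x, y⁆ ∈ commutator G :=
  Subgroup.commutator_mem_commutator (Subgroup.mem_top x) (Subgroup.mem_top y)

theorem commutatorElement_mul_left (hG : commutator G ≤ Subgroup.center G) (x y z : G) :
    ⁅x * y, z⁆ = ⁅x, z⁆ * ⁅y, z⁆ := by
  have h := Subgroup.mem_center_iff.mp (hG (commutatorElement_mem_commutator y z))
  calc ⁅x * y, z⁆ = x * ⁅y, z⁆ * (z * x⁻¹ * z⁻¹) := by simp only [commutatorElement_def]; group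
    _ = ⁅x, z⁆ * ⁅y, z⁆ := by
      rw [h x, mul_assoc, ← h]; simp only [commutatorElement_def]; group

theorem commutatorElement_mul_right (hG : commutator G ≤ Subgroup.center G) (x y z : G) :
    ⁅x, y * z⁆ = ⁅x, y⁆ * ⁅x, z⁆ := by
  have h := Subgroup.mem_center_iff.mp (hG (commutatorElement_mem_commutator x z))
  rw [← commutatorElement_inv (y * z) x, commutatorElement_mul_left hG, mul_inv_rev,
    commutatorElement_inv, commutatorElement_inv, h]

/-- In class two the commutator is multiplicative in each variable, so commutators of generators
suffice. -/
theorem commutator_fg_of_fg (hG : commutator G ≤ Subgroup.center G) (hfg : Group.FG G) :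
    (commutator G).FG := by
  obtain ⟨S, hS, hfin⟩ := Group.fg_iff.mp hfg
  refine (Subgroup.fg_iff _).mpr ⟨Set.image2 (fun x y => ⁅x, y⁆) S S, ?_, hfin.image2 _ hfin⟩
  apply le_antisymm
  · rw [Subgroup.closure_le]
    rintro _ ⟨x, -, y, -, rfl⟩
    exact commutatorElement_mem_commutator x y
  · rw [commutator_def, Subgroup.commutator_le]
    intro x _ y _
    have hx : x ∈ Subgroup.closure S := hS ▸ Subgroup.mem_top x
    have hy : y ∈ Subgroup.closure S := hS ▸ Subgroup.mem_top y
    have inv_left : ∀ a b : G, ⁅a⁻¹, b⁆ = ⁅a, b⁆⁻¹ := fun a b => by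
      rw [eq_inv_iff_mul_eq_one, ← commutatorElement_mul_left hG, inv_mul_cancel,
        commutatorElement_one_left]
    have inv_right : ∀ a b : G, ⁅a, b⁻¹⁆ = ⁅a, b⁆⁻¹ := fun a b => by
      rw [eq_inv_iff_mul_eq_one, ← commutatorElement_mul_right hG, inv_mul_cancel,
        commutatorElement_one_right]
    induction hx, hy using Subgroup.closure_induction₂ with
    | mem x y hx hy => exact Subgroup.subset_closure ⟨x, hx, y, hy, rfl⟩
    | one_left x hx => rw [commutatorElement_one_left]; exact one_mem _
    | one_right x hx => rw [commutatorElement_one_right]; exact one_mem _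
    | mul_left x y z _ _ _ h₁ h₂ =>
      rw [commutatorElement_mul_left hG]
      exact mul_mem (h₁ trivial trivial) (h₂ trivial trivial)
    | mul_right x y z _ _ _ h₁ h₂ =>
      rw [commutatorElement_mul_right hG]
      exact mul_mem (h₁ trivial trivial) (h₂ trivial trivial)
    | inv_left x y _ _ h => rw [inv_left]; exact inv_mem (h trivial trivial)
    | inv_right x y _ _ h => rw [inv_right]; exact inv_mem (h trivial trivial)

end ClassTwo

theorem Subgroup.fg_of_isMulCommutative {A : Type u} [Group A] [IsMulCommutative A] [Group.FG A]
    (E : Subgroup A) : E.FG := by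
  let : CommGroup A := { (inferInstance : Group A) with mul_comm := mul_comm' }
  have : AddGroup.FG (Additive A) := inferInstance
  have : Module.Finite ℤ (Additive A) := Module.Finite.iff_addGroup_fg.mpr this
  have h := IsNoetherian.noetherian (AddSubgroup.toIntSubmodule E.toAddSubgroup)
  rw [Submodule.fg_iff_addSubgroup_fg, AddSubgroup.toIntSubmodule_toAddSubgroup] at h
  exact (Subgroup.fg_iff_add_fg E).mpr h

/-! ### Rational characters from the divisibility of `ℚ` -/

section Extension

/-- A homomorphism from a subgroup `H` to `ℚ` that vanishes on `H ∩ [G, G]` extends to `G`. -/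
theorem exists_rat_hom_extension {G : Type u} [Group G] (H : Subgroup G) (g : G → ℚ)
    (hmul : ∀ x ∈ H, ∀ y ∈ H, g (x * y) = g x + g y)
    (hcomm : ∀ x ∈ H, x ∈ commutator G → g x = 0) :
    ∃ l : G → ℚ, (∀ x y, l (x * y) = l x + l y) ∧ ∀ x ∈ H, l x = g x := by
  let φ : H →* Multiplicative ℚ :=
    MonoidHom.mk' (fun x => Multiplicative.ofAdd (g x)) fun x y => hmul x x.2 y y.2
  let q := (Abelianization.of : G →* Abelianization G).subgroupMap H
  have hq : Function.Surjective q := MonoidHom.subgroupMap_surjective _ _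
  -- The kernel of `q` is `H ∩ [G, G]`, so `φ` descends to the image of `H` in the abelianization,
  -- where injectivity of `ℚ` applies.
  have hker : q.ker ≤ φ.ker := fun x hx => by
    have : (Abelianization.of (x : G)) = 1 := congrArg Subtype.val hx
    exact congrArg Multiplicative.ofAdd (hcomm x x.2 ((QuotientGroup.eq_one_iff _).mp this))
  let ψ := q.liftOfSurjective hq ⟨φ, hker⟩
  have hψ : ∀ x, ψ (q x) = φ x := MonoidHom.liftOfRightInverse_comp_apply _ _ _ ⟨φ, hker⟩
  obtain ⟨h, hh⟩ := (Module.Baer.of_divisible ℚ).extension_property_addMonoidHom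
    (MonoidHom.toAdditive (H.map (Abelianization.of : G →* Abelianization G)).subtype)
    Subtype.val_injective (MonoidHom.toAdditiveLeft ψ)
  refine ⟨fun x => h (Additive.ofMul (Abelianization.of x)), fun x y => ?_, fun x hx => ?_⟩
  · simp only [map_mul, ofMul_mul, map_add]
  · exact (DFunLike.congr_fun hh (Additive.ofMul (q ⟨x, hx⟩))).trans
      (congrArg Multiplicative.toAdd (hψ ⟨x, hx⟩))

/-- An element of an abelian group without a positive power in the subgroup `N` is detected by a
rational character that vanishes on `N`. -/
theorem exists_rat_hom_of_pow_notMem {A : Type u} [Group A] [IsMulCommutative A]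
    (N : Subgroup A) (c : A)
    (hc : ∀ n : ℕ, 0 < n → c ^ n ∉ N) :
    ∃ i : A → ℚ, (∀ x y, i (x * y) = i x + i y) ∧ (∀ x ∈ N, i x = 0) ∧ i c = 1 := by
  let : CommGroup A := { (inferInstance : Group A) with mul_comm := mul_comm' }
  let f : ℤ →+ Additive (A ⧸ N) := zmultiplesHom _ (Additive.ofMul (c : A ⧸ N))
  have hf : Function.Injective f := by
    rw [injective_iff_map_eq_zero]
    intro n hn
    by_contra hne
    have h1 : (c : A ⧸ N) ^ n = 1 := hn
    have h2 : (c : A ⧸ N) ^ n.natAbs = 1 := by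
      rcases Int.natAbs_eq n with h | h <;> rw [h] at h1 <;> simpa using h1
    exact hc n.natAbs (Int.natAbs_pos.mpr hne) ((QuotientGroup.eq_one_iff _).mp h2)
  obtain ⟨h, hh⟩ := (Module.Baer.of_divisible ℚ).extension_property_addMonoidHom f hf
    (Int.castAddHom ℚ)
  refine ⟨fun x => h (Additive.ofMul (x : A ⧸ N)), fun x y => ?_, fun x hx => ?_, ?_⟩
  · simp only [QuotientGroup.mk_mul, ofMul_mul, map_add]
  · simp only [(QuotientGroup.eq_one_iff x).mpr hx, ofMul_one, map_zero]
  · simpa [f] using DFunLike.congr_fun hh 1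

end Extension

/-! ### Central extensions by `ℚ` with a bimultiplicative cocycle -/

section TwistedProduct

/-- A function of two variables that is additive in each of them. -/
structure IsBimultiplicative {G : Type u} [Group G] (β : G → G → ℚ) : Prop where
  mul_left : ∀ x y z, β (x * y) z = β x z + β y z
  mul_right : ∀ x y z, β x (y * z) = β x y + β x z

namespace IsBimultiplicative

variable {G : Type u} [Group G] {β : G → G → ℚ} (hβ : IsBimultiplicative β)
include hβ

theorem one_left (x : G) : β 1 x = 0 := by simpa using hβ.mul_left 1 1 x

theorem one_right (x : G) : β x 1 = 0 := by simpa using hβ.mul_right x 1 1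

theorem inv_left (x y : G) : β x⁻¹ y = -β x y := by
  have := hβ.mul_left x⁻¹ x y
  rw [inv_mul_cancel, hβ.one_left] at this
  linarith

theorem const_mul (r : ℚ) : IsBimultiplicative fun x y => r * β x y where
  mul_left x y z := by rw [hβ.mul_left, mul_add]
  mul_right x y z := by rw [hβ.mul_right, mul_add]

end IsBimultiplicative

/-- The central extension of `G` by `ℚ` with the bimultiplicative cocycle `β`. -/
@[ext]
structure TwistedProduct {G : Type u} [Group G] {β : G → G → ℚ}
    (hβ : IsBimultiplicative β) where
  fst : G
  snd : ℚ

namespace TwistedProduct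

variable {G : Type u} [Group G] {β : G → G → ℚ} {hβ : IsBimultiplicative β}

instance : Mul (TwistedProduct hβ) := ⟨fun x y => ⟨x.fst * y.fst, x.snd + y.snd + β x.fst y.fst⟩⟩

instance : One (TwistedProduct hβ) := ⟨⟨1, 0⟩⟩

instance : Inv (TwistedProduct hβ) := ⟨fun x => ⟨x.fst⁻¹, -x.snd + β x.fst x.fst⟩⟩

@[simp] theorem fst_mul (x y : TwistedProduct hβ) : (x * y).fst = x.fst * y.fst := rfl

@[simp] theorem snd_mul (x y : TwistedProduct hβ) :
    (x * y).snd = x.snd + y.snd + β x.fst y.fst := rfl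

@[simp] theorem fst_one : (1 : TwistedProduct hβ).fst = 1 := rfl

@[simp] theorem snd_one : (1 : TwistedProduct hβ).snd = 0 := rfl

@[simp] theorem fst_inv (x : TwistedProduct hβ) : x⁻¹.fst = x.fst⁻¹ := rfl

@[simp] theorem snd_inv (x : TwistedProduct hβ) : x⁻¹.snd = -x.snd + β x.fst x.fst := rfl

instance : Group (TwistedProduct hβ) :=
  Group.ofLeftAxioms
    (fun x y z => by
      ext
      · simp [mul_assoc]
      · simp [hβ.mul_left, hβ.mul_right]; ring)
    (fun x => by ext <;> simp [hβ.one_left])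
    (fun x => by ext <;> simp [hβ.inv_left])

theorem fst_commutatorElement (x y : TwistedProduct hβ) : ⁅x, y⁆.fst = ⁅x.fst, y.fst⁆ := by
  simp [commutatorElement_def]

/-- Compare second coordinates in `⁅x, y⁆ (y x) = x y`; the hypothesis removes the cocycle term on
the left. -/
theorem snd_commutatorElement (x y : TwistedProduct hβ) (h : ∀ z, β ⁅x.fst, y.fst⁆ z = 0) :
    ⁅x, y⁆.snd = β x.fst y.fst - β y.fst x.fst := by
  have e : (⁅x, y⁆ * (y * x)).snd = (x * y).snd :=
    congrArg snd (by simp only [commutatorElement_def]; group)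
  rw [snd_mul, fst_commutatorElement, h, snd_mul, snd_mul] at e
  linarith

/-- A central extension of an abelian group has class at most two. -/
theorem isNilpotentOfClassLE_two (hG : ∀ x y : G, x * y = y * x) :
    IsNilpotentOfClassLE 2 (TwistedProduct hβ) := by
  rw [isNilpotentOfClassLE_two_iff, commutator_def, Subgroup.commutator_le]
  intro x _ y _
  have h : ⁅x, y⁆.fst = 1 := by
    rw [fst_commutatorElement, commutatorElement_eq_one_iff_mul_comm, hG]
  rw [Subgroup.mem_center_iff]
  intro z
  ext
  · simp [h]
  · simp [h, hβ.one_left, hβ.one_right, add_comm]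

end TwistedProduct

end TwistedProduct

/-! ### Separating derived elements by two maps to a Heisenberg group -/

section Separation

variable {G : Type u} [Group G]

/-- A rational character `i` of the center of a group of class two extends from the derived
subgroup to a function whose failure to be additive is half of the commutator form. -/
theorem exists_quadratic_extension (hG : commutator G ≤ Subgroup.center G) {i : G → ℚ}
    (hi : ∀ x ∈ Subgroup.center G, ∀ y ∈ Subgroup.center G, i (x * y) = i x + i y)
    (hω : IsBimultiplicative fun x y : G => i ⁅x, y⁆) :
    ∃ s : G → ℚ, (∀ x y, s (x * y) = s x + s y + 1 / 2 * i ⁅x, y⁆) ∧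
      ∀ c ∈ commutator G, s c = i c := by
  have i_one : i 1 = 0 := by simpa using hi 1 (one_mem _) 1 (one_mem _)
  have central_left : ∀ c ∈ Subgroup.center G, ∀ y, i ⁅c, y⁆ = 0 := fun c hc y => by
    rw [commutatorElement_eq_one_iff_mul_comm.mpr (Subgroup.mem_center_iff.mp hc y).symm, i_one]
  have skew : ∀ x y : G, i ⁅y, x⁆ = -i ⁅x, y⁆ := fun x y => by
    have h := hi _ (hG (commutatorElement_mem_commutator x y)) _
      (hG (commutatorElement_mem_commutator y x))
    rw [← commutatorElement_inv x y, mul_inv_cancel, i_one] at h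
    rw [← commutatorElement_inv x y]
    linarith
  -- With this factor, skewness gives `⁅x, y⁆` in the extension the second coordinate `-i` of its
  -- first. So the derived subgroup meets the central copy `Z` of `ℚ` trivially, and the coordinate
  -- on `Z` extends to a character `r`.
  have hβ := hω.const_mul (-1 / 2)
  have comm_snd : ∀ m ∈ commutator (TwistedProduct hβ),
      m.fst ∈ commutator G ∧ m.snd = -i m.fst := by
    intro m hm
    rw [commutator_eq_closure] at hm
    induction hm using Subgroup.closure_induction with
    | mem m hm =>
      obtain ⟨x, y, rfl⟩ := hm
      rw [TwistedProduct.snd_commutatorElement, TwistedProduct.fst_commutatorElement]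
      · refine ⟨commutatorElement_mem_commutator _ _, ?_⟩
        rw [skew x.fst y.fst]
        ring
      · intro z
        rw [central_left _ (hG (commutatorElement_mem_commutator _ _)), mul_zero]
    | one => exact ⟨one_mem _, by simp [i_one]⟩
    | mul x y _ _ hx hy =>
      refine ⟨mul_mem hx.1 hy.1, ?_⟩
      rw [TwistedProduct.snd_mul, TwistedProduct.fst_mul, hi _ (hG hx.1) _ (hG hy.1), hx.2, hy.2,
        central_left _ (hG hx.1)]
      ring
    | inv x _ hx =>
      refine ⟨inv_mem hx.1, ?_⟩
      have h := hi _ (hG hx.1) _ (inv_mem (hG hx.1))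
      rw [mul_inv_cancel, i_one] at h
      rw [TwistedProduct.snd_inv, TwistedProduct.fst_inv, hx.2, central_left _ (hG hx.1)]
      linarith
  let Z : Subgroup (TwistedProduct hβ) :=
    { carrier := {m | m.fst = 1}
      one_mem' := rfl
      mul_mem' := fun {x y} hx hy => by
        change x.fst * y.fst = 1
        rw [show x.fst = 1 from hx, show y.fst = 1 from hy, one_mul]
      inv_mem' := fun {x} hx => by
        change x.fst⁻¹ = 1
        rw [show x.fst = 1 from hx, inv_one] }
  obtain ⟨r, r_mul, hr⟩ := exists_rat_hom_extension Z TwistedProduct.snd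
    (fun x hx y _ => by
      rw [TwistedProduct.snd_mul, show x.fst = 1 from hx, hβ.one_left, add_zero])
    (fun x hx hx' => by
      rw [(comm_snd x hx').2, show x.fst = 1 from hx, i_one, neg_zero])
  have s_mul : ∀ x y, r ⟨x * y, 0⟩ = r ⟨x, 0⟩ + r ⟨y, 0⟩ + 1 / 2 * i ⁅x, y⁆ := by
    intro x y
    have e : (⟨x, 0⟩ * ⟨y, 0⟩ : TwistedProduct hβ) = ⟨1, -1 / 2 * i ⁅x, y⁆⟩ * ⟨x * y, 0⟩ := by
      ext
      · simp
      · simp [i_one]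
    have h := congrArg r e
    rw [r_mul, r_mul, hr ⟨1, _⟩ rfl] at h
    linarith
  refine ⟨fun x => r ⟨x, 0⟩, s_mul, fun c hc => ?_⟩
  change r ⟨c, 0⟩ = i c
  have hc' := hc
  rw [commutator_eq_closure] at hc'
  induction hc' using Subgroup.closure_induction with
  | mem m hm =>
    obtain ⟨x, y, rfl⟩ := hm
    -- Expanding `s (x y)` and `s (y x)`, the two halves of the form add up to `i ⁅x, y⁆`.
    have h := s_mul ⁅x, y⁆ (y * x)
    rw [central_left _ (hG hc), show ⁅x, y⁆ * (y * x) = x * y by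
      simp only [commutatorElement_def]; group, s_mul, s_mul, skew x y] at h
    linarith
  | one => rw [i_one]; exact hr _ rfl
  | mul x y hx hy h₁ h₂ =>
    rw [← commutator_eq_closure] at hx hy
    rw [s_mul, h₁ hx, h₂ hy, central_left _ (hG hx), hi _ (hG hx) _ (hG hy)]
    ring
  | inv x hx h =>
    rw [← commutator_eq_closure] at hx
    have h₁ := hi _ (hG hx) _ (inv_mem (hG hx))
    have h₂ := s_mul x x⁻¹
    have h₃ : r ⟨1, 0⟩ = 0 := hr _ rfl
    rw [mul_inv_cancel, i_one] at h₁
    rw [mul_inv_cancel, h₃, central_left _ (hG hx), h hx] at h₂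
    linarith

/-- A bimultiplicative form is the restriction of a bilinear form on the rationalization of the
abelianization. -/
theorem IsBimultiplicative.exists_bilinear {ω : G → G → ℚ} (hω : IsBimultiplicative ω) :
    ∃ B : (ℚ ⊗[ℤ] Additive (Abelianization G)) →ₗ[ℚ]
        (ℚ ⊗[ℤ] Additive (Abelianization G)) →ₗ[ℚ] ℚ,
      ∀ x y : G, B (1 ⊗ₜ Additive.ofMul (Abelianization.of x))
        (1 ⊗ₜ Additive.ofMul (Abelianization.of y)) = ω x y := by
  let form (x : G) : Additive (Abelianization G) →+ ℚ :=
    MonoidHom.toAdditiveLeft (Abelianization.lift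
      (MonoidHom.mk' (fun y => Multiplicative.ofAdd (ω x y)) fun y z => hω.mul_right x y z))
  have form_apply : ∀ x y, form x (Additive.ofMul (Abelianization.of y)) = ω x y :=
    fun x y => rfl
  let extended (x : G) : (ℚ ⊗[ℤ] Additive (Abelianization G)) →ₗ[ℚ] ℚ :=
    (form x).toIntLinearMap.liftBaseChange ℚ
  have extended_mul : ∀ x y, extended (x * y) = extended x + extended y := fun x y => by
    have : form (x * y) = form x + form y := by
      ext z
      exact hω.mul_left x y z
    ext z
    simp [extended, this]
  let total : Additive (Abelianization G) →+ (ℚ ⊗[ℤ] Additive (Abelianization G)) →ₗ[ℚ] ℚ :=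
    MonoidHom.toAdditiveLeft (Abelianization.lift
      (MonoidHom.mk' (fun x => Multiplicative.ofAdd (extended x)) extended_mul))
  have total_apply : ∀ x, total (Additive.ofMul (Abelianization.of x)) = extended x :=
    fun x => rfl
  refine ⟨total.toIntLinearMap.liftBaseChange ℚ, fun x y => ?_⟩
  rw [LinearMap.liftBaseChange_one_tmul, AddMonoidHom.coe_toIntLinearMap, total_apply,
    LinearMap.liftBaseChange_one_tmul, AddMonoidHom.coe_toIntLinearMap, form_apply]

/-- An element of the derived subgroup that lies in the dominion of `H` has a power in `H`. -/
theorem exists_pow_mem_of_mem_dominion_of_mem_commutator (hG : IsNilpotentOfClassLE 2 G)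
    (H : Subgroup G) {c : G} (hc : c ∈ commutator G)
    (hd : c ∈ dominion (IsNilpotentOfClassLE 2) H) : ∃ n : ℕ, 0 < n ∧ c ^ n ∈ H := by
  rw [isNilpotentOfClassLE_two_iff] at hG
  by_contra! hpow
  obtain ⟨i', i'_mul, i'_H, i'_c⟩ := exists_rat_hom_of_pow_notMem
    (H.subgroupOf (Subgroup.center G)) (⟨c, hG hc⟩ : Subgroup.center G) fun n hn hmem => hpow n hn hmem
  classical
  -- The value 0 off the center is arbitrary: `i` is only evaluated at central elements.
  let i : G → ℚ := fun x => if hx : x ∈ Subgroup.center G then i' ⟨x, hx⟩ else 0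
  have i_eq : ∀ x (hx : x ∈ Subgroup.center G), i x = i' ⟨x, hx⟩ := fun x hx => dif_pos hx
  have hi : ∀ x ∈ Subgroup.center G, ∀ y ∈ Subgroup.center G, i (x * y) = i x + i y :=
    fun x hx y hy => by
      rw [i_eq _ hx, i_eq _ hy, i_eq _ (mul_mem hx hy), ← i'_mul]; rfl
  have i_H : ∀ x ∈ H, x ∈ Subgroup.center G → i x = 0 := fun x hx hx' => by
    rw [i_eq _ hx']; exact i'_H _ hx
  have i_c : i c = 1 := by rw [i_eq _ (hG hc), i'_c]
  have hcomm : ∀ x y : G, ⁅x, y⁆ ∈ Subgroup.center G :=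
    fun x y => hG (commutatorElement_mem_commutator x y)
  have hω : IsBimultiplicative fun x y : G => i ⁅x, y⁆ :=
    ⟨fun x y z => by rw [commutatorElement_mul_left hG, hi _ (hcomm _ _) _ (hcomm _ _)],
      fun x y z => by rw [commutatorElement_mul_right hG, hi _ (hcomm _ _) _ (hcomm _ _)]⟩
  have ω_H : ∀ x ∈ H, ∀ y ∈ H, i ⁅x, y⁆ = 0 := fun x hx y hy =>
    i_H _ (by
      rw [commutatorElement_def]
      exact mul_mem (mul_mem (mul_mem hx hy) (inv_mem hx)) (inv_mem hy)) (hcomm x y)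
  obtain ⟨s, s_mul, s_comm⟩ := exists_quadratic_extension hG hi hω
  obtain ⟨l, l_mul, l_H⟩ := exists_rat_hom_extension H s
    (fun x hx y hy => by rw [s_mul, ω_H x hx y hy, mul_zero, add_zero])
    (fun x hx hx' => by rw [s_comm x hx', i_H x hx (hG hx')])
  obtain ⟨B, hB⟩ := hω.exists_bilinear
  let V := ℚ ⊗[ℤ] Additive (Abelianization G)
  let j : G → V := fun x => 1 ⊗ₜ Additive.ofMul (Abelianization.of x)
  have j_mul : ∀ x y, j (x * y) = j x + j y := fun x y => by
    simp only [j, map_mul, ofMul_mul, TensorProduct.tmul_add]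
  have j_comm : j c = 0 := by
    have : (Abelianization.of c : Abelianization G) = 1 := (QuotientGroup.eq_one_iff c).mpr hc
    simp only [j, this, ofMul_one, TensorProduct.tmul_zero]
  let W : Submodule ℚ V := Submodule.span ℚ (j '' H)
  -- Rationalizing makes the span of `H` a direct summand, which the image of `H` in the
  -- abelianization need not be.
  obtain ⟨p, hp⟩ := W.subtype.exists_leftInverse_of_injective W.ker_subtype
  have p_H : ∀ x ∈ H, (p (j x) : V) = j x := fun x hx =>
    congrArg Subtype.val (DFunLike.congr_fun hp ⟨j x, Submodule.subset_span ⟨x, hx, rfl⟩⟩)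
  have B_W : ∀ v w : W, B v w = 0 := by
    rintro ⟨v, hv⟩ ⟨w, hw⟩
    change B v w = 0
    induction hv, hw using Submodule.span_induction₂ with
    | mem_mem v w hv hw =>
      obtain ⟨x, hx, rfl⟩ := hv
      obtain ⟨y, hy, rfl⟩ := hw
      exact (hB x y).trans (ω_H x hx y hy)
    | zero_left => simp
    | zero_right => simp
    | add_left _ _ _ _ _ _ h₁ h₂ => simp [h₁, h₂]
    | add_right _ _ _ _ _ _ h₁ h₂ => simp [h₁, h₂]
    | smul_left _ _ _ _ _ h => simp [h]
    | smul_right _ _ _ _ _ h => simp [h]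
  have hβ : IsBimultiplicative fun v w : Multiplicative V => 1 / 2 * B v.toAdd w.toAdd :=
    ⟨fun x y z => by simp [mul_add], fun x y z => by simp [mul_add]⟩
  let f : G →* TwistedProduct hβ :=
    MonoidHom.mk' (fun x => ⟨Multiplicative.ofAdd (j x), s x⟩) fun x y => by
      ext
      · exact j_mul x y
      · exact (s_mul x y).trans (by rw [← hB]; rfl)
  -- The cocycle vanishes on `W`, so additivity of `l` is all that the second coordinate needs.
  let g : G →* TwistedProduct hβ :=
    MonoidHom.mk' (fun x => ⟨Multiplicative.ofAdd (p (j x) : V), l x⟩) fun x y => by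
      ext
      · exact congrArg (fun v : W => Multiplicative.ofAdd (v : V))
          ((congrArg p (j_mul x y)).trans (map_add p _ _))
      · change l (x * y) = l x + l y + 1 / 2 * B (p (j x)) (p (j y))
        rw [l_mul, B_W, mul_zero, add_zero]
  have key : f c = g c := hd _ (TwistedProduct.isNilpotentOfClassLE_two mul_comm) f g
    fun x hx => by
      ext
      · exact congrArg Multiplicative.ofAdd (p_H x hx).symm
      · exact (l_H x hx).symm
  have l_c : l c = 0 := by
    let l' : G →* Multiplicative ℚ := MonoidHom.mk' (fun x => Multiplicative.ofAdd (l x)) l_mul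
    exact congrArg Multiplicative.toAdd (Abelianization.commutator_subset_ker l' hc)
  have h : s c = l c := congrArg TwistedProduct.snd key
  rw [s_comm c hc, i_c, l_c] at h
  exact one_ne_zero h

end Separation

/-! ### The dominion modulo the derived subgroup, and the main theorem -/

section Dominion

variable {G : Type u} [Group G]

theorem le_dominion (C : (K : Type u) → [Group K] → Prop) (H : Subgroup G) : H ≤ dominion C H :=
  fun h hh _ _ _ _ _ hfg => hfg h hh

/-- Elements of the dominion of `H` lie in `H` modulo the derived subgroup. -/
theorem exists_mul_of_mem_dominion (H : Subgroup G) {d : G}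
    (hd : d ∈ dominion (IsNilpotentOfClassLE 2) H) :
    ∃ h ∈ H, ∃ c ∈ commutator G, d = h * c := by
  let N := H.map (Abelianization.of : G →* Abelianization G)
  have hK : IsNilpotentOfClassLE 2 (Abelianization G ⧸ N) := by
    rw [isNilpotentOfClassLE_two_iff]
    intro x _
    exact Subgroup.mem_center_iff.mpr fun y => mul_comm y x
  -- The quotient map and the trivial homomorphism agree on `H`.
  have h := hd (Abelianization G ⧸ N) hK ((QuotientGroup.mk' N).comp Abelianization.of) 1
    fun x hx => (QuotientGroup.eq_one_iff _).mpr ⟨x, hx, rfl⟩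
  obtain ⟨x, hx, hxd⟩ := (QuotientGroup.eq_one_iff _).mp h
  exact ⟨x, hx, x⁻¹ * d, QuotientGroup.eq.mp hxd, by group⟩

end Dominion

theorem corollary3p33 (G : Type u) [Group G] (hG : IsNilpotentOfClassLE 2 G) (H : Subgroup G) :
    (∀ d ∈ dominion (IsNilpotentOfClassLE 2) H, ∃ n : ℕ, 0 < n ∧ d ^ n ∈ H) ∧
    H ≤ dominion (IsNilpotentOfClassLE 2) H ∧
    (H.subgroupOf (dominion (IsNilpotentOfClassLE 2) H)).Normal ∧
    (Group.FG G → (H.subgroupOf (dominion (IsNilpotentOfClassLE 2) H)).FiniteIndex) := by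
  have hcen := isNilpotentOfClassLE_two_iff.mp hG
  have hle := le_dominion (IsNilpotentOfClassLE 2) H
  set D := dominion (IsNilpotentOfClassLE 2) H
  have htors : ∀ d ∈ D, ∃ n : ℕ, 0 < n ∧ d ^ n ∈ H := by
    intro d hd
    obtain ⟨h, hh, c, hc, rfl⟩ := exists_mul_of_mem_dominion H hd
    have hcD : c ∈ D := (D.mul_mem_cancel_left (hle hh)).mp hd
    obtain ⟨n, hn, hcn⟩ := exists_pow_mem_of_mem_dominion_of_mem_commutator hG H hc hcD
    refine ⟨n, hn, ?_⟩
    rw [(show Commute h c from Subgroup.mem_center_iff.mp (hcen hc) h).mul_pow]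
    exact mul_mem (pow_mem hh n) hcn
  have hnormal : (H.subgroupOf D).Normal := by
    refine ⟨fun x hx d => ?_⟩
    obtain ⟨h, hh, c, hc, hd⟩ := exists_mul_of_mem_dominion H d.2
    have hcx := Subgroup.mem_center_iff.mp (hcen hc) x
    change (d : G) * x * (d : G)⁻¹ ∈ H
    -- The central factor `c` of `d` drops out of the conjugation.
    have : (d : G) * x * (d : G)⁻¹ = h * x * h⁻¹ := by
      rw [hd, mul_inv_rev, mul_assoc h, ← hcx]; group
    rw [this]
    exact mul_mem (mul_mem hh hx) (inv_mem hh)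
  refine ⟨htors, hle, hnormal, fun hfg => ?_⟩
  have : IsMulCommutative (commutator G) :=
    ⟨⟨fun a b => Subtype.ext (Subgroup.mem_center_iff.mp (hcen b.2) a)⟩⟩
  have : Group.FG (commutator G) :=
    (Group.fg_iff_subgroup_fg _).mpr (commutator_fg_of_fg hcen hfg)
  let E := D.subgroupOf (commutator G)
  have : Group.FG E := (Group.fg_iff_subgroup_fg E).mpr (Subgroup.fg_of_isMulCommutative E)
  let φ : E →* D ⧸ H.subgroupOf D := (QuotientGroup.mk' _).comp
    (MonoidHom.mk' (fun x => ⟨x, x.2⟩) fun _ _ => rfl)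
  -- A coset of `h c` is also the coset of `c`, and `c = h⁻¹ (h c)` stays in `D`.
  have hφ : Function.Surjective φ := by
    intro q
    obtain ⟨⟨d, hd⟩, rfl⟩ := QuotientGroup.mk_surjective q
    obtain ⟨h, hh, c, hc, rfl⟩ := exists_mul_of_mem_dominion H hd
    have hcD : c ∈ D := (D.mul_mem_cancel_left (hle hh)).mp hd
    refine ⟨⟨⟨c, hc⟩, hcD⟩, QuotientGroup.eq.mpr ?_⟩
    change c⁻¹ * (h * c) ∈ H
    rwa [Subgroup.mem_center_iff.mp (hcen hc) h, inv_mul_cancel_left]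
  have : Group.FG (D ⧸ H.subgroupOf D) := Group.fg_of_surjective hφ
  let : CommGroup (D ⧸ H.subgroupOf D) :=
    { (inferInstance : Group (D ⧸ H.subgroupOf D)) with
      mul_comm := fun a b => by
        obtain ⟨a, rfl⟩ := hφ a
        obtain ⟨b, rfl⟩ := hφ b
        change φ a * φ b = φ b * φ a
        rw [← map_mul, ← map_mul, show a * b = b * a from Subtype.ext (mul_comm' _ _)] }
  have : Finite (D ⧸ H.subgroupOf D) := CommGroup.finite_of_fg_isMulTorsion _ fun q => by
    obtain ⟨d, rfl⟩ := QuotientGroup.mk_surjective q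
    obtain ⟨n, hn, hdn⟩ := htors d d.2
    exact isOfFinOrder_iff_pow_eq_one.mpr ⟨n, hn, (QuotientGroup.eq_one_iff (d ^ n)).mpr hdn⟩
  exact Subgroup.finiteIndex_of_finite_quotient
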